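/- Let $M=(M_j)_{j\in\mathbb{N}}$ (with $\mathbb N=\{0,1,2,\dots\}$) be a log-convex weight sequence, i.e. a sequence of positive reals with $M_0=1$, $\lim_{j\to\infty}(M_j)^{1/j}=+\infty$ and $M_j^2\le M_{j-1}M_{j+1}$ for all $j\ge 1$. Put $\omega_M(0):=0$ and $\omega_M(t):=\sup_{j\in\mathbb{N}}\log\left(t^j/M_j\right)$ for $t>0$, and for $c>0$ let $v_{M,c}(t):=\exp(-\omega_M(ct))$, $t\ge 0$. Let $H^\infty_{v_{M,c}}$ be the space of all entire functions $f$ with $\|f\|_{v_{M,c}}:=\sup_{z\in\mathbb{C}}|f(z)|\,v_{M,c}(|z|)<+\infty$, endowed with this norm. Define the (LB)-space $$H^\infty_{\underline{\mathcal M}_{\mathfrak c}}:=\varinjlim_{n\to\infty}H^\infty_{v_{M,n}}=\bigcup_{n\in\mathbb{N}_{>0}}H^\infty_{v_{M,n}}$$ with the locally convex inductive limit topology (the finest locally convex vector space topology for which all the inclusions of the $H^\infty_{v_{M,n}}$ are continuous), and the Fréchet space $$H^\infty_{\overline{\mathcal M}_{\mathfrak c}}:=\varprojlim_{n\to\infty}H^\infty_{v_{M,1/n}}=\bigcap_{n\in\mathbb{N}_{>0}}H^\infty_{v_{M,1/n}}$$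 with the projective limit topology. Then the following are equivalent: (i) $H^\infty_{\underline{\mathcal M}_{\mathfrak c}}$ is closed under pointwise multiplication, and the bilinear map $(f,g)\mapsto f\cdot g$ is continuous from $H^\infty_{\underline{\mathcal M}_{\mathfrak c}}\times H^\infty_{\underline{\mathcal M}_{\mathfrak c}}$ to $H^\infty_{\underline{\mathcal M}_{\mathfrak c}}$; (ii) $H^\infty_{\overline{\mathcal M}_{\mathfrak c}}$ is closed under pointwise multiplication, and the bilinear map $(f,g)\mapsto f\cdot g$ is continuous from $H^\infty_{\overline{\mathcal M}_{\mathfrak c}}\times H^\infty_{\overline{\mathcal M}_{\mathfrak c}}$ to $H^\infty_{\overline{\mathcal M}_{\mathfrak c}}$; (iii) $M$ has moderate growth (mg): there is $C\ge 1$ such that $M_{j+k}\le C^{j+k}M_jM_k$ for all $j,k\in\mathbb{N}$. -/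

import Mathlib

open Filter Topology

/-! ### Weight sequences -/

/-- A weight sequence: `M_j > 0` for all `j`, `M_0 = 1` and `(M_j)^{1/j} → +∞`. -/
structure IsWeightSequence (M : ℕ → ℝ) : Prop where
  pos : ∀ j, 0 < M j
  zero : M 0 = 1
  tendsto_root : Tendsto (fun j : ℕ => M j ^ ((1 : ℝ) / (j : ℝ))) atTop atTop

/-- Log-convexity: `M_j ^ 2 ≤ M_{j-1} M_{j+1}` for all `j ≥ 1`. -/
def IsLogConvex (M : ℕ → ℝ) : Prop :=
  ∀ j : ℕ, M (j + 1) ^ 2 ≤ M j * M (j + 2)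

/-- Moderate growth (mg). -/
def ModerateGrowth (M : ℕ → ℝ) : Prop :=
  ∃ C : ℝ, 1 ≤ C ∧ ∀ j k : ℕ, M (j + k) ≤ C ^ (j + k) * M j * M k

/-- The associated weight function `ω_M(t) = sup_j log (t ^ j / M_j)` for `t > 0`, `ω_M(0) = 0`.
For a weight sequence `M` the supremum is finite for every `t > 0`
(`IsWeightSequence.bddAbove_log`). Only arguments `t ≥ 0` are used. -/
noncomputable def assocFun (M : ℕ → ℝ) (t : ℝ) : ℝ :=
  if t = 0 then 0 else ⨆ j : ℕ, Real.log (t ^ j / M j)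

theorem IsWeightSequence.bddAbove_log {M : ℕ → ℝ} (hM : IsWeightSequence M) {t : ℝ} (ht : 0 < t) :
    BddAbove (Set.range fun j : ℕ => Real.log (t ^ j / M j)) := by
  have h : ∀ᶠ j : ℕ in atTop, Real.log (t ^ j / M j) ≤ 0 := by
    filter_upwards [hM.tendsto_root.eventually_ge_atTop t, eventually_ge_atTop 1] with j hj hj1
    have hj0 : (j : ℝ) ≠ 0 := by positivity
    have h1 : t ^ j ≤ M j := by
      calc t ^ j ≤ (M j ^ ((1 : ℝ) / (j : ℝ))) ^ j := pow_le_pow_left₀ ht.le hj j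
        _ = M j := by
          rw [← Real.rpow_natCast, ← Real.rpow_mul (hM.pos j).le, one_div,
            inv_mul_cancel₀ hj0, Real.rpow_one]
    exact Real.log_nonpos (div_nonneg (pow_nonneg ht.le j) (hM.pos j).le)
      ((div_le_one (hM.pos j)).2 h1)
  exact (isBoundedUnder_of_eventually_le h).bddAbove_range

/-! ### Weighted spaces of entire functions -/

/-- A strictly positive radial weight `t ↦ v(t)`, evaluated at `t = |z| ≥ 0` only. -/
abbrev RadialWeight : Type := ℝ → {x : ℝ // 0 < x}

/-- `H^∞_v`: the entire functions `f` with `sup_z |f(z)| v(|z|) < ∞`. -/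
def HInf (v : RadialWeight) : Submodule ℂ (ℂ → ℂ) where
  carrier := {f | Differentiable ℂ f ∧ BddAbove (Set.range fun z : ℂ => ‖f z‖ * (v ‖z‖ : ℝ))}
  zero_mem' := ⟨differentiable_const 0, 0, by rintro _ ⟨z, rfl⟩; simp⟩
  add_mem' := by
    rintro f g ⟨hf, A, hA⟩ ⟨hg, B, hB⟩
    refine ⟨hf.add hg, A + B, ?_⟩
    rintro _ ⟨z, rfl⟩
    have h1 := hA ⟨z, rfl⟩
    have h2 := hB ⟨z, rfl⟩
    have h3 := mul_le_mul_of_nonneg_right (norm_add_le (f z) (g z)) (v ‖z‖).2.le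
    simp only [Pi.add_apply] at *
    linarith
  smul_mem' := by
    rintro c f ⟨hf, A, hA⟩
    refine ⟨hf.const_smul c, ‖c‖ * A, ?_⟩
    rintro _ ⟨z, rfl⟩
    have h1 := mul_le_mul_of_nonneg_left (hA ⟨z, rfl⟩) (norm_nonneg c)
    simp only [Pi.smul_apply, norm_smul, mul_assoc] at *
    exact h1

/-- The norm `‖f‖_v = sup_z |f(z)| v(|z|)` of `H^∞_v`. -/
noncomputable def hInfNorm (v : RadialWeight) : AddGroupNorm (HInf v) where
  toFun f := ⨆ z : ℂ, ‖(f : ℂ → ℂ) z‖ * (v ‖z‖ : ℝ)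
  map_zero' := by simp
  add_le' := by
    intro f g
    refine ciSup_le fun z => ?_
    have h1 := le_ciSup f.2.2 z
    have h2 := le_ciSup g.2.2 z
    have h3 := mul_le_mul_of_nonneg_right
      (norm_add_le ((f : ℂ → ℂ) z) ((g : ℂ → ℂ) z)) (v ‖z‖).2.le
    simp only [Submodule.coe_add, Pi.add_apply] at *
    linarith
  neg' := by intro f; simp
  eq_zero_of_map_eq_zero' := by
    intro f hf
    ext z
    have h1 := le_ciSup f.2.2 z
    have h2 : ‖(f : ℂ → ℂ) z‖ * (v ‖z‖ : ℝ) ≤ 0 := h1.trans hf.le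
    have h3 : ‖(f : ℂ → ℂ) z‖ ≤ 0 := nonpos_of_mul_nonpos_left h2 (v ‖z‖).2
    simpa using h3

/-- The norm topology of `H^∞_v`. -/
@[reducible] noncomputable def hInfTopology (v : RadialWeight) : TopologicalSpace (HInf v) :=
  (hInfNorm v).toNormedAddCommGroup.toUniformSpace.toTopologicalSpace

/-- The vector space underlying the inductive limit of the spaces `H^∞_{v_n}`, `n ≥ 1`.
For a non-increasing sequence of weights it is the union of these spaces
(`mem_indLimit_iff`). -/
def indLimit (V : ℕ+ → RadialWeight) : Submodule ℂ (ℂ → ℂ) :=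
  ⨆ n, HInf (V n)

theorem HInf_mono {v w : RadialWeight} (h : ∀ t, 0 ≤ t → (w t : ℝ) ≤ v t) : HInf v ≤ HInf w := by
  rintro f ⟨hf, A, hA⟩
  refine ⟨hf, A, ?_⟩
  rintro _ ⟨z, rfl⟩
  exact (mul_le_mul_of_nonneg_left (h _ (norm_nonneg z)) (norm_nonneg _)).trans (hA ⟨z, rfl⟩)

theorem mem_indLimit_iff {V : ℕ+ → RadialWeight}
    (hV : ∀ m n : ℕ+, m ≤ n → ∀ t, 0 ≤ t → (V n t : ℝ) ≤ V m t) {f : ℂ → ℂ} :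
    f ∈ indLimit V ↔ ∃ n, f ∈ HInf (V n) :=
  Submodule.mem_iSup_of_directed _
    (Monotone.directed_le fun m n hmn => HInf_mono (hV m n hmn))

/-- The locally convex inductive limit ((LB)-space) topology: the finest locally convex vector
space topology for which all the inclusions of the normed spaces `H^∞_{v_n}` are continuous. -/
@[reducible] noncomputable def indLimitTopology (V : ℕ+ → RadialWeight) : TopologicalSpace (indLimit V) :=
  sInf {t : TopologicalSpace (indLimit V) |
    (∀ n : ℕ+, @Continuous (HInf (V n)) (indLimit V) (hInfTopology (V n)) t
      (Submodule.inclusion (le_iSup (fun k => HInf (V k)) n))) ∧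
    @IsTopologicalAddGroup (indLimit V) t _ ∧
    @ContinuousSMul ℂ (indLimit V) _ _ t ∧
    @LocallyConvexSpace ℝ (indLimit V) _ _ _ _ t}

/-- The vector space underlying the projective limit of the spaces `H^∞_{v_n}`, `n ≥ 1`, namely
their intersection. -/
def projLimit (V : ℕ+ → RadialWeight) : Submodule ℂ (ℂ → ℂ) :=
  ⨅ n, HInf (V n)

/-- The projective limit (Fréchet space) topology: the coarsest topology for which all the
inclusions into the normed spaces `H^∞_{v_n}` are continuous. -/
@[reducible] noncomputable def projLimitTopology (V : ℕ+ → RadialWeight) : TopologicalSpace (projLimit V) :=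
  ⨅ n : ℕ+, TopologicalSpace.induced
    (Submodule.inclusion (iInf_le (fun k => HInf (V k)) n)) (hInfTopology (V n))

/-- The space of functions `E`, with the topology `t`, is closed under pointwise multiplication and
the bilinear multiplication operator `(f, g) ↦ f · g` is (jointly) continuous `E × E → E`. -/
def ClosedUnderContinuousMul (E : Submodule ℂ (ℂ → ℂ)) (t : TopologicalSpace E) : Prop :=
  ∃ h : ∀ f ∈ E, ∀ g ∈ E, f * g ∈ E,
    @Continuous (E × E) E (@instTopologicalSpaceProd E E t t) t
      (fun p => ⟨(p.1 : ℂ → ℂ) * (p.2 : ℂ → ℂ), h p.1 p.1.2 p.2 p.2.2⟩)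

/-! ### Dilatation-type weight systems of a weight sequence -/

/-- The weight `v_{M,c}(t) = exp (-ω_M(c t))`. -/
noncomputable def seqWeight (M : ℕ → ℝ) (c : ℝ) : RadialWeight :=
  fun t => ⟨Real.exp (-assocFun M (c * t)), Real.exp_pos _⟩

/-- The non-increasing dilatation-type system `(v_{M,c})_{c = 1, 2, …}`. -/
noncomputable def lowerDilatation (M : ℕ → ℝ) : ℕ+ → RadialWeight :=
  fun c => seqWeight M ((c : ℕ) : ℝ)

/-- The non-decreasing dilatation-type system `(v_{M,1/c})_{c = 1, 2, …}`. -/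
noncomputable def upperDilatation (M : ℕ → ℝ) : ℕ+ → RadialWeight :=
  fun c => seqWeight M (1 / ((c : ℕ) : ℝ))

theorem IsWeightSequence.assocFun_mono {M : ℕ → ℝ} (hM : IsWeightSequence M) {s t : ℝ}
    (hs : 0 ≤ s) (hst : s ≤ t) : assocFun M s ≤ assocFun M t := by
  unfold assocFun
  rcases hs.eq_or_lt with rfl | hs
  · rcases hst.eq_or_lt with rfl | ht
    · exact le_rfl
    · rw [if_pos rfl, if_neg ht.ne']
      have h1 := le_ciSup (hM.bddAbove_log ht) 0
      simpa [hM.zero] using h1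
  · have ht := hs.trans_le hst
    rw [if_neg hs.ne', if_neg ht.ne']
    refine ciSup_mono (hM.bddAbove_log ht) fun j => ?_
    have := hM.pos j
    exact Real.log_le_log (by positivity) (by gcongr)

/-- For a weight sequence the (LB)-space of dilatation type is the union of its steps. -/
theorem IsWeightSequence.mem_indLimit_iff {M : ℕ → ℝ} (hM : IsWeightSequence M) {f : ℂ → ℂ} :
    f ∈ indLimit (lowerDilatation M) ↔ ∃ n, f ∈ HInf (lowerDilatation M n) := by
  refine _root_.mem_indLimit_iff fun m n hmn t ht => ?_
  have h : ((m : ℕ) : ℝ) ≤ ((n : ℕ) : ℝ) := by exact_mod_cast hmn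
  exact Real.exp_le_exp.2 (neg_le_neg
    (hM.assocFun_mono (by positivity) (mul_le_mul_of_nonneg_right h ht)))

/-! Since `f * g` lies in `HInf w` for `f`, `g` in `HInf v` as soon as w ≤ v², the question is
whether the dilatations absorb squares of weights, that is, whether 2ω_M(t) ≤ ω_M(Ht) + const.

Moderate growth says (t^j/M_j)(t^k/M_k) ≤ (Ct)^(j+k)/M_(j+k); suprema over j and k give 2ω_M(t) ≤
ω_M(Nt) (`ModerateGrowth.exists_exp_assocFun_sq_le`). Both spaces are then closed under products,
with norm estimates between steps. For the Fréchet space these estimates are continuity. For the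
(LB)-space, joint continuity comes from `continuous_bilinear_indLimit`: the steps are normed and
linearly ordered, so one can build a single seminorm p with q(xy) ≤ p(x)p(y).

Conversely, log-convexity makes t = M_(p+1)/M_p a point where the supremum in ω_M is attained at p
(`IsLogConvex.exp_assocFun_ratio`), so growth bounds on ω_M return bounds on M_p. In the (LB)-case
the square of one function, `weightSeries M`, supplies the bound, and closedness alone suffices. In
the Fréchet case continuity is tested on monomials, z^j z^k = z^(j+k). -/

/-! ### Seminorm criteria for bilinear maps -/

section
open scoped ComplexOrder

/-- The nonnegative elements of ℂ are exactly the nonnegative reals, so convexity over ℝ and over ℂ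
agree. This provides complex seminorms for a topology that is only known to be locally convex over
ℝ. -/
theorem polynormableSpace_of_locallyConvexSpace_real {E : Type*} [AddCommGroup E] [Module ℂ E]
    [Module ℝ E] [IsScalarTower ℝ ℂ E] [TopologicalSpace E] [IsTopologicalAddGroup E]
    [ContinuousSMul ℂ E] [LocallyConvexSpace ℝ E] : PolynormableSpace ℂ E := by
  have : LocallyConvexSpace ℂ E := by
    constructor
    intro x
    refine (LocallyConvexSpace.convex_basis (𝕜 := ℝ) x).to_hasBasis
      (fun s hs => ⟨s, ⟨hs.1, ?_⟩, le_rfl⟩) (fun s hs => ⟨s, ⟨hs.1, hs.2.lift ℝ⟩, le_rfl⟩)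
    exact convex_of_nonneg_surjective_algebraMap ℂ
        (fun _ h => RCLike.nonneg_iff_exists_ofReal.mp h) hs.2
  have : ContinuousSMul ℝ E := IsScalarTower.continuousSMul ℂ
  exact LocallyConvexSpace.toPolynormableSpace

end

theorem WithSeminorms.continuous_bilinear {E ι : Type*} [AddCommGroup E] [Module ℂ E]
    [TopologicalSpace E] {P : SeminormFamily ℂ E ι} (hP : WithSeminorms P)
    (B : E →ₗ[ℂ] E →ₗ[ℂ] E)
    (h : ∀ i, ∃ q : Seminorm ℂ E, Continuous q ∧ ∀ x y, P i (B x y) ≤ q x * q y) :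
    Continuous fun p : E × E => B p.1 p.2 := by
  have := hP.topologicalAddGroup
  rw [continuous_iff_continuousAt]
  rintro ⟨x, y⟩
  refine (hP.tendsto_nhds _ _).2 ?_
  intro i ε hε
  obtain ⟨q, hq, hB⟩ := h i
  have h1 : Tendsto (fun p : E × E => q (p.1 - x) * q p.2 + q x * q (p.2 - y)) (𝓝 (x, y))
      (𝓝 (q (x - x) * q y + q x * q (y - y))) :=
    Continuous.tendsto (by fun_prop) (x, y)
  simp only [sub_self, map_zero, zero_mul, mul_zero, add_zero] at h1
  filter_upwards [h1.eventually_lt_const hε] with p hp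
  have h2 : B p.1 p.2 - B x y = B (p.1 - x) p.2 + B x (p.2 - y) := by
    simp [map_sub]
  rw [h2]
  exact ((map_add_le_add _ _ _).trans (add_le_add (hB _ _) (hB _ _))).trans_lt hp

theorem WithSeminorms.exists_bound_of_continuous_bilinear {E : Type*} {ι : Type*}
    [AddCommGroup E] [Module ℂ E] [TopologicalSpace E] [Preorder ι] [IsDirectedOrder ι]
    [Nonempty ι] {P : SeminormFamily ℂ E ι} (hP : WithSeminorms P) (hmono : Monotone P)
    (B : E →ₗ[ℂ] E →ₗ[ℂ] E) (hB : Continuous fun p : E × E => B p.1 p.2) (i : ι) :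
    ∃ j, ∃ C : ℝ, 0 < C ∧ ∀ x y a b, 0 < a → 0 < b → P j x ≤ a → P j y ≤ b →
      P i (B x y) ≤ C * (a * b) := by
  have h1 : Tendsto (fun p : E × E => P i (B p.1 p.2)) (𝓝 ((0 : E), (0 : E))) (𝓝 0) := by
    have := ((hP.continuous_seminorm i).comp hB).tendsto (0, 0)
    simpa using! this
  have h2 := h1.eventually_lt_const one_pos
  rw [nhds_prod_eq, eventually_iff, mem_prod_self_iff] at h2
  obtain ⟨U, hU, hUB⟩ := h2
  obtain ⟨s, r, hr, hs⟩ := (hP.mem_nhds_iff 0 U).1 hU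
  -- Directedness replaces the finite supremum by one seminorm.
  obtain ⟨j, hj⟩ := s.exists_le
  have hsj : s.sup P ≤ P j := Finset.sup_le fun k hk => hmono (hj k hk)
  -- Scaling by a positive upper bound `a` instead of `P j x` covers vectors with `P j x = 0`; the 2
  -- gives strict inequality.
  have key : ∀ (x : E) (a : ℝ), 0 < a → P j x ≤ a → ((r / (2 * a) : ℝ) : ℂ) • x ∈ U := by
    intro x a ha hx
    apply hs
    rw [Seminorm.mem_ball_zero, map_smul_eq_mul, Complex.norm_real, Real.norm_of_nonneg (by positivity)]
    calc r / (2 * a) * (s.sup P) x ≤ r / (2 * a) * a := by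
          gcongr
          exact (hsj x).trans hx
      _ = r / 2 := by field_simp
      _ < r := by linarith
  refine ⟨j, 4 / r ^ 2, by positivity, fun x y a b ha hb hx hy => ?_⟩
  have h3 := hUB (Set.mk_mem_prod (key x a ha hx) (key y b hb hy))
  simp only [Set.mem_ofPred_eq, map_smul, LinearMap.smul_apply, map_smul_eq_mul,
    Complex.norm_real] at h3
  rw [Real.norm_of_nonneg (by positivity), Real.norm_of_nonneg (by positivity)] at h3
  have h4 : r / (2 * a) * (r / (2 * b) * P i (B x y)) = P i (B x y) / (4 / r ^ 2 * (a * b)) := by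
    field_simp
    ring
  rw [mul_left_comm, h4, div_lt_one (by positivity)] at h3
  exact h3.le

/-! ### Seminorms on the steps and on the projective limit -/

/-- The norm of `H^∞_v` as a seminorm over `ℂ`. -/
noncomputable def hInfSeminorm (v : RadialWeight) : Seminorm ℂ (HInf v) :=
  Seminorm.of (hInfNorm v) (map_add_le_add _) fun c f => by
    change (⨆ z : ℂ, ‖c * (f : ℂ → ℂ) z‖ * (v ‖z‖ : ℝ)) =
      ‖c‖ * ⨆ z : ℂ, ‖(f : ℂ → ℂ) z‖ * (v ‖z‖ : ℝ)
    simp only [norm_mul, mul_assoc]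
    rw [Real.mul_iSup_of_nonneg (norm_nonneg c)]

theorem le_hInfSeminorm {v : RadialWeight} (f : HInf v) (z : ℂ) :
    ‖(f : ℂ → ℂ) z‖ * (v ‖z‖ : ℝ) ≤ hInfSeminorm v f :=
  le_ciSup f.2.2 z

theorem hInfSeminorm_le {v : RadialWeight} (f : HInf v) {a : ℝ}
    (h : ∀ z, ‖(f : ℂ → ℂ) z‖ * (v ‖z‖ : ℝ) ≤ a) : hInfSeminorm v f ≤ a :=
  ciSup_le h

theorem withSeminorms_hInfSeminorm (v : RadialWeight) :
    @WithSeminorms ℂ (HInf v) (Fin 1) _ _ _ (fun _ => hInfSeminorm v) (hInfTopology v) := by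
  let _ := (hInfNorm v).toNormedAddCommGroup
  let _ : NormedSpace ℂ (HInf v) := ⟨fun c f => (map_smul_eq_mul (hInfSeminorm v) c f).le⟩
  exact norm_withSeminorms ℂ (HInf v)

/-- The seminorms defining the projective limit. -/
noncomputable def projSeminorm (V : ℕ+ → RadialWeight) : SeminormFamily ℂ (projLimit V) ℕ+ :=
  fun n => (hInfSeminorm (V n)).comp (Submodule.inclusion (iInf_le (fun k => HInf (V k)) n))

theorem withSeminorms_projLimit (V : ℕ+ → RadialWeight) :
    @WithSeminorms ℂ (projLimit V) ℕ+ _ _ _ (projSeminorm V) (projLimitTopology V) := by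
  have h := withSeminorms_iInf (𝕜 := ℂ) (E := projLimit V) (κ := fun _ : ℕ+ => Fin 1)
    (p := fun n _ => projSeminorm V n)
    (t := fun n => (hInfTopology (V n)).induced
      (Submodule.inclusion (iInf_le (fun k => HInf (V k)) n)))
    fun n => @LinearMap.withSeminorms_induced ℂ ℂ (projLimit V) (HInf (V n)) (Fin 1) _ _ _ _ _ _
      _ _ (hInfTopology (V n)) _ (withSeminorms_hInfSeminorm (V n))
      (Submodule.inclusion (iInf_le (fun k => HInf (V k)) n))
  exact @WithSeminorms.congr_equiv _ _ _ _ _ _ _ _ (projLimitTopology V) h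
    (Equiv.sigmaUnique ℕ+ fun _ => Fin 1).symm

/-! ### The inductive limit and joint continuity -/

/-- The canonical map of a step into the inductive limit. -/
def stepInclusion (V : ℕ+ → RadialWeight) (n : ℕ+) : HInf (V n) →ₗ[ℂ] indLimit V :=
  Submodule.inclusion (le_iSup (fun k => HInf (V k)) n)

theorem polynormableSpace_indLimit (V : ℕ+ → RadialWeight) :
    @PolynormableSpace ℂ (indLimit V) _ _ _ (indLimitTopology V) := by
  let _ := indLimitTopology V
  have : IsTopologicalAddGroup (indLimit V) := topologicalAddGroup_sInf fun t ht => ht.2.1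
  have : ContinuousSMul ℂ (indLimit V) := continuousSMul_sInf fun t ht => ht.2.2.1
  have : LocallyConvexSpace ℝ (indLimit V) := LocallyConvexSpace.sInf fun t ht => ht.2.2.2
  exact polynormableSpace_of_locallyConvexSpace_real

theorem continuous_stepInclusion (V : ℕ+ → RadialWeight) (n : ℕ+) :
    @Continuous _ _ (hInfTopology (V n)) (indLimitTopology V) (stepInclusion V n) :=
  continuous_sInf_rng.2 fun _ ht => ht.1 n

/-- The topology generated by `p` alone is one of the topologies over which `indLimitTopology` is
the infimum. -/
theorem continuous_seminorm_indLimit (V : ℕ+ → RadialWeight) (p : Seminorm ℂ (indLimit V))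
    (hp : ∀ n, ∃ C : ℝ, ∀ f, p (stepInclusion V n f) ≤ C * hInfSeminorm (V n) f) :
    @Continuous _ _ (indLimitTopology V) _ p := by
  let P : SeminormFamily ℂ (indLimit V) (Fin 1) := fun _ => p
  let t := P.moduleFilterBasis.topology
  have ht : WithSeminorms P := ⟨rfl⟩
  have hc : Continuous p := ht.continuous_seminorm 0
  have hle : indLimitTopology V ≤ t := by
    refine sInf_le ⟨fun n => ?_, ht.topologicalAddGroup, ht.continuousSMul,
      ht.toLocallyConvexSpace⟩
    let _ := hInfTopology (V n)
    have hn := withSeminorms_hInfSeminorm (V n)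
    have := hn.topologicalAddGroup
    refine WithSeminorms.continuous_of_isBounded hn ht (stepInclusion V n) fun _ => ?_
    obtain ⟨C, hC⟩ := hp n
    refine ⟨{0}, ⟨max C 0, le_max_right _ _⟩, fun f => ?_⟩
    simp only [Finset.sup_singleton]
    refine (hC f).trans ?_
    exact mul_le_mul_of_nonneg_right (le_max_left _ _) (apply_nonneg _ _)
  exact continuous_le_dom hle hc

theorem exists_bound_of_continuous_seminorm_indLimit (V : ℕ+ → RadialWeight)
    (p : Seminorm ℂ (indLimit V)) (hp : @Continuous _ _ (indLimitTopology V) _ p) (n : ℕ+) :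
    ∃ C : ℝ, 0 ≤ C ∧ ∀ f, p (stepInclusion V n f) ≤ C * hInfSeminorm (V n) f := by
  let _ := (hInfNorm (V n)).toNormedAddCommGroup
  let _ : NormedSpace ℂ (HInf (V n)) :=
    ⟨fun c f => (map_smul_eq_mul (hInfSeminorm (V n)) c f).le⟩
  let _ : TopologicalSpace (HInf (V n)) := hInfTopology (V n)
  let _ := indLimitTopology V
  obtain ⟨C, hC, h⟩ := Seminorm.bound_of_continuous_normedSpace (p.comp (stepInclusion V n))
    (hp.comp (continuous_stepInclusion V n))
  exact ⟨C, hC.le, h⟩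

/-- A bilinear map on an inductive limit `E = ⋃ E_n` of an increasing sequence of the normed
spaces `H^∞_{v_n}` which maps each `E_n × E_n` boundedly into some `E_m` is continuous. -/
theorem continuous_bilinear_indLimit {V : ℕ+ → RadialWeight}
    (hV : ∀ m n : ℕ+, m ≤ n → ∀ t, 0 ≤ t → (V n t : ℝ) ≤ V m t)
    (B : indLimit V →ₗ[ℂ] indLimit V →ₗ[ℂ] indLimit V)
    (hB : ∀ n, ∃ m, ∃ C : ℝ, ∀ f g, ∃ h, stepInclusion V m h =
      B (stepInclusion V n f) (stepInclusion V n g) ∧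
      hInfSeminorm (V m) h ≤ C * (hInfSeminorm (V n) f * hInfSeminorm (V n) g)) :
    @Continuous _ _ (@instTopologicalSpaceProd _ _ (indLimitTopology V) (indLimitTopology V))
      (indLimitTopology V) fun p : indLimit V × indLimit V => B p.1 p.2 := by
  let _ := indLimitTopology V
  have := polynormableSpace_indLimit V
  refine (PolynormableSpace.withSeminorms ℂ (indLimit V)).continuous_bilinear B ?_
  rintro ⟨q, hq⟩
  have hbd : ∀ n, ∃ L : ℝ, 0 ≤ L ∧ ∀ f g, q (B (stepInclusion V n f) (stepInclusion V n g)) ≤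
      L * (hInfSeminorm (V n) f * hInfSeminorm (V n) g) := by
    intro n
    obtain ⟨m, C, hC⟩ := hB n
    obtain ⟨K, hK0, hK⟩ := exists_bound_of_continuous_seminorm_indLimit V q hq m
    refine ⟨K * max C 0, by positivity, fun f g => ?_⟩
    obtain ⟨h, hh, hle⟩ := hC f g
    rw [← hh, mul_assoc]
    refine (hK h).trans (mul_le_mul_of_nonneg_left (hle.trans ?_) hK0)
    exact mul_le_mul_of_nonneg_right (le_max_left _ _)
      (mul_nonneg (apply_nonneg _ _) (apply_nonneg _ _))
  choose L hL0 hL using hbd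
  have hmono : ∀ m n : ℕ+, m ≤ n → ∀ f : HInf (V m), ∃ f' : HInf (V n),
      stepInclusion V n f' = stepInclusion V m f ∧
        hInfSeminorm (V n) f' ≤ hInfSeminorm (V m) f := by
    intro m n hmn f
    refine ⟨⟨f, HInf_mono (hV m n hmn) f.2⟩, rfl, hInfSeminorm_le _ fun z => ?_⟩
    exact (mul_le_mul_of_nonneg_left (hV m n hmn _ (norm_nonneg z)) (norm_nonneg _)).trans
      (le_hInfSeminorm f z)
  -- Chosen so that both `L m` and `L n`, hence the constant at the larger index, are at most `a m *
  -- a n`; this decouples the two variables.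
  let a : ℕ+ → ℝ := fun n => 1 + L n
  have ha1 : ∀ n, 1 ≤ a n := fun n => le_add_of_nonneg_right (hL0 n)
  have hprod : ∀ m n f g, q (B (stepInclusion V m f) (stepInclusion V n g)) ≤
      (a m * hInfSeminorm (V m) f) * (a n * hInfSeminorm (V n) g) := by
    intro m n f g
    have hf0 := apply_nonneg (hInfSeminorm (V m)) f
    have hg0 := apply_nonneg (hInfSeminorm (V n)) g
    rw [mul_mul_mul_comm]
    rcases le_total m n with hmn | hmn
    · obtain ⟨f', hf', hle⟩ := hmono m n hmn f
      rw [← hf']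
      refine (hL n f' g).trans (mul_le_mul ?_ ?_ ?_ ?_)
      · nlinarith [ha1 m, ha1 n, show a n = 1 + L n from rfl, hL0 n]
      · exact mul_le_mul_of_nonneg_right hle hg0
      · exact mul_nonneg (apply_nonneg _ _) hg0
      · exact mul_nonneg (zero_le_one.trans (ha1 m)) (zero_le_one.trans (ha1 n))
    · obtain ⟨g', hg', hle⟩ := hmono n m hmn g
      rw [← hg']
      refine (hL m f g').trans (mul_le_mul ?_ ?_ ?_ ?_)
      · nlinarith [ha1 m, ha1 n, show a m = 1 + L m from rfl, hL0 m]
      · exact mul_le_mul_of_nonneg_left hle hf0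
      · exact mul_nonneg hf0 (apply_nonneg _ _)
      · exact mul_nonneg (zero_le_one.trans (ha1 m)) (zero_le_one.trans (ha1 n))
  -- The gauge of the absolutely convex hull of the union of the balls of radius `1 / a n`.
  let A : Set (Seminorm ℂ (indLimit V)) :=
    {r | ∀ n f, r (stepInclusion V n f) ≤ a n * hInfSeminorm (V n) f}
  have hstep : ∀ x : indLimit V, ∃ n f, stepInclusion V n f = x := by
    intro x
    obtain ⟨n, hn⟩ := (mem_indLimit_iff hV).1 x.2
    exact ⟨n, ⟨x, hn⟩, rfl⟩
  have hA : BddAbove A := by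
    rw [Seminorm.bddAbove_iff, bddAbove_pi]
    intro x
    obtain ⟨n, f, rfl⟩ := hstep x
    refine ⟨a n * hInfSeminorm (V n) f, ?_⟩
    rintro _ ⟨_, ⟨r, hr, rfl⟩, rfl⟩
    exact hr n f
  have hAne : A.Nonempty :=
    ⟨0, fun n f => mul_nonneg (zero_le_one.trans (ha1 n)) (apply_nonneg _ _)⟩
  have hpA : ∀ r ∈ A, ∀ x, r x ≤ sSup A x := fun r hr => le_csSup hA hr
  have hpbd : ∀ n f, sSup A (stepInclusion V n f) ≤ a n * hInfSeminorm (V n) f := by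
    intro n f
    rw [Seminorm.sSup_apply hA]
    have := hAne.to_subtype
    exact ciSup_le fun r => r.2 n f
  -- Maximality of `sSup A` with a constant; `c = 0` is separate because `r` is divided by `c`.
  have hscale : ∀ (r : Seminorm ℂ (indLimit V)) (c : ℝ), 0 ≤ c →
      (∀ n f, r (stepInclusion V n f) ≤ c * (a n * hInfSeminorm (V n) f)) →
      ∀ x, r x ≤ c * sSup A x := by
    intro r c hc hr x
    rcases hc.eq_or_lt with rfl | hc
    · obtain ⟨n, f, rfl⟩ := hstep x
      simpa using hr n f
    · have hmem : (NNReal.mk c⁻¹ (inv_pos.2 hc).le) • r ∈ A := fun n f => by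
        change c⁻¹ * r _ ≤ _
        rw [inv_mul_le_iff₀ hc]
        exact hr n f
      have h := hpA _ hmem x
      change c⁻¹ * r x ≤ _ at h
      rwa [inv_mul_le_iff₀ hc] at h
  refine ⟨sSup A, continuous_seminorm_indLimit V _ fun n => ⟨a n, hpbd n⟩, fun x y => ?_⟩
  -- Maximality is used once per variable: in `y` with `x` fixed, then in `x` with `y` replaced by a
  -- step element `g`.
  refine hscale (q.comp (B x)) (sSup A x) (apply_nonneg _ _) (fun n g => ?_) y
  have h := hscale (q.comp (B.flip (stepInclusion V n g))) (a n * hInfSeminorm (V n) g)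
    (mul_nonneg (zero_le_one.trans (ha1 n)) (apply_nonneg _ _))
    (fun m f => (hprod m n f g).trans_eq (mul_comm _ _)) x
  exact h.trans_eq (mul_comm _ _)

/-! ### The associated function and moderate growth -/

section Weights

variable {M : ℕ → ℝ}

theorem IsWeightSequence.pow_div_le_exp_assocFun (hM : IsWeightSequence M) {t : ℝ} (ht : 0 ≤ t)
    (j : ℕ) : t ^ j / M j ≤ Real.exp (assocFun M t) := by
  rcases ht.eq_or_lt with rfl | ht
  · rcases j.eq_zero_or_pos with rfl | hj
    · simp [hM.zero, assocFun]
    · simp [hj.ne', Real.exp_nonneg]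
  · rw [← Real.log_le_iff_le_exp (div_pos (pow_pos ht j) (hM.pos j)), assocFun, if_neg ht.ne']
    exact le_ciSup (hM.bddAbove_log ht) j

theorem IsWeightSequence.exp_assocFun_le (hM : IsWeightSequence M) {t a : ℝ} (ht : 0 ≤ t)
    (h : ∀ j, t ^ j / M j ≤ a) : Real.exp (assocFun M t) ≤ a := by
  have ha : 1 ≤ a := by simpa [hM.zero] using h 0
  rw [← Real.le_log_iff_exp_le (by linarith), assocFun]
  split_ifs with h0
  · exact Real.log_nonneg ha
  · have ht' : 0 < t := lt_of_le_of_ne ht (Ne.symm h0)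
    exact ciSup_le fun j => Real.log_le_log (div_pos (pow_pos ht' j) (hM.pos j)) (h j)

theorem IsLogConvex.ratio_monotone (hlc : IsLogConvex M) (hM : IsWeightSequence M) :
    Monotone fun j => M (j + 1) / M j := by
  refine monotone_nat_of_le_succ fun j => ?_
  rw [div_le_div_iff₀ (hM.pos _) (hM.pos _)]
  have := hlc j
  nlinarith

/-- The supremum defining `ω_M` at `M_{p+1} / M_p` is attained at the index `p`. -/
theorem IsLogConvex.exp_assocFun_ratio (hlc : IsLogConvex M) (hM : IsWeightSequence M) (p : ℕ) :
    Real.exp (assocFun M (M (p + 1) / M p)) ≤ (M (p + 1) / M p) ^ p / M p := by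
  have hpos : ∀ j, 0 < M (j + 1) / M j := fun j => div_pos (hM.pos _) (hM.pos _)
  have hsucc : ∀ j, M (j + 1) = M j * (M (j + 1) / M j) := fun j =>
    (mul_div_cancel₀ _ (hM.pos j).ne').symm
  -- `M (i + k) / M i` is a product of `k` successive ratios, each at most the ratio at index `i +
  -- k`; `hdown` is the mirror estimate above `p`.
  have hup : ∀ k i, M (i + k) ≤ M i * (M (i + k + 1) / M (i + k)) ^ k := by
    intro k
    induction k with
    | zero => simp
    | succ k ih =>
      intro i
      calc M (i + (k + 1)) = M (i + k) * (M (i + k + 1) / M (i + k)) := hsucc (i + k)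
        _ ≤ M i * (M (i + k + 1) / M (i + k)) ^ k * (M (i + k + 1) / M (i + k)) :=
          mul_le_mul_of_nonneg_right (ih i) (hpos _).le
        _ = M i * (M (i + k + 1) / M (i + k)) ^ (k + 1) := by ring
        _ ≤ _ := mul_le_mul_of_nonneg_left (pow_le_pow_left₀ (hpos _).le
          (hlc.ratio_monotone hM (Nat.le_succ (i + k))) _) (hM.pos i).le
  have hdown : ∀ k, M p * (M (p + 1) / M p) ^ k ≤ M (p + k) := by
    intro k
    induction k with
    | zero => simp
    | succ k ih =>
      calc M p * (M (p + 1) / M p) ^ (k + 1)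
          = M p * (M (p + 1) / M p) ^ k * (M (p + 1) / M p) := by ring
        _ ≤ M (p + k) * (M (p + k + 1) / M (p + k)) :=
          mul_le_mul ih (hlc.ratio_monotone hM (Nat.le_add_right p k)) (hpos _).le (hM.pos _).le
        _ = _ := (hsucc (p + k)).symm
  refine hM.exp_assocFun_le (hpos p).le fun i => ?_
  rw [div_le_div_iff₀ (hM.pos _) (hM.pos _)]
  rcases le_total i p with h | h
  · obtain ⟨k, rfl⟩ := Nat.exists_eq_add_of_le h
    refine (mul_le_mul_of_nonneg_left (hup k i) (pow_nonneg (hpos _).le _)).trans_eq ?_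
    ring
  · obtain ⟨k, rfl⟩ := Nat.exists_eq_add_of_le h
    refine le_trans (le_of_eq ?_)
      (mul_le_mul_of_nonneg_left (hdown k) (pow_nonneg (hpos p).le _))
    ring

/-- A constant factor is absorbed into the power once j + k ≥ 1, and at j = k = 0 the claim holds
because M_0 = 1. -/
theorem IsWeightSequence.moderateGrowth_of_le (hM : IsWeightSequence M) {A H : ℝ} (hH : 0 ≤ H)
    (h : ∀ j k, M (j + k) ≤ A * H ^ (j + k) * (M j * M k)) : ModerateGrowth M := by
  have hA : 1 ≤ max 1 A := le_max_left _ _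
  have hH1 : 1 ≤ max 1 H := le_max_left _ _
  refine ⟨max 1 A * max 1 H, one_le_mul_of_one_le_of_one_le hA hH1, fun j k => ?_⟩
  rw [mul_assoc]
  have hjk := mul_pos (hM.pos j) (hM.pos k)
  rcases (j + k).eq_zero_or_pos with h0 | h0
  · obtain ⟨rfl, rfl⟩ : j = 0 ∧ k = 0 := by omega
    simp [hM.zero]
  · refine (h j k).trans (mul_le_mul_of_nonneg_right ?_ hjk.le)
    rw [mul_pow]
    refine mul_le_mul ((le_max_right 1 A).trans (le_self_pow₀ hA h0.ne'))
      (pow_le_pow_left₀ hH (le_max_right _ _) _) (by positivity) (by positivity)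

theorem IsLogConvex.moderateGrowth_of_exp_assocFun (hlc : IsLogConvex M) (hM : IsWeightSequence M)
    {A H : ℝ} (hH : 0 < H)
    (h : ∀ t, 0 < t → ∀ j k, t ^ j / M j * (t ^ k / M k) ≤ A * Real.exp (assocFun M (H * t))) :
    ModerateGrowth M := by
  refine hM.moderateGrowth_of_le (A := A) hH.le fun j k => ?_
  set p := j + k with hp
  set s := M (p + 1) / M p
  have hs : 0 < s := div_pos (hM.pos _) (hM.pos _)
  have hA : 0 ≤ A := by
    have := h 1 one_pos 0 0
    simp only [pow_zero, hM.zero, div_one, mul_one] at this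
    exact nonneg_of_mul_nonneg_left (zero_le_one.trans this) (Real.exp_pos _)
  -- At t = s/H the right side is evaluated at `s`, where the supremum is attained at `p = j + k`;
  -- the powers of `s` then cancel.
  have h1 := (h (s / H) (div_pos hs hH) j k).trans
    (mul_le_mul_of_nonneg_left (b := Real.exp (assocFun M (H * (s / H)))) (c := s ^ p / M p)
      (by rw [mul_div_cancel₀ _ hH.ne']; exact hlc.exp_assocFun_ratio hM p) hA)
  have hj := hM.pos j
  have hk := hM.pos k
  have hpp := hM.pos p
  have h2 : (s / H) ^ j / M j * ((s / H) ^ k / M k) = s ^ p / (H ^ p * (M j * M k)) := by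
    rw [div_mul_div_comm, ← pow_add, ← hp, div_pow, div_div]
  rw [h2, ← mul_div_assoc, div_le_div_iff₀ (by positivity) hpp] at h1
  have h3 : s ^ p * M p ≤ s ^ p * (A * H ^ p * (M j * M k)) := h1.trans_eq (by ring)
  exact le_of_mul_le_mul_left h3 (pow_pos hs p)

theorem ModerateGrowth.exists_exp_assocFun_sq_le (h : ModerateGrowth M) (hM : IsWeightSequence M) :
    ∃ N : ℕ+, ∀ t, 0 ≤ t → Real.exp (assocFun M t) * Real.exp (assocFun M t) ≤
      Real.exp (assocFun M ((N : ℕ) * t)) := by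
  obtain ⟨C, hC, hmg⟩ := h
  obtain ⟨n, hn⟩ := exists_nat_ge C
  refine ⟨⟨n + 1, n.succ_pos⟩, fun t ht => ?_⟩
  have hCN : C ≤ ((n + 1 : ℕ) : ℝ) := by push_cast; linarith
  rcases ht.eq_or_lt with rfl | ht
  · simp [assocFun]
  -- Each factor is isolated in turn, so that its supremum can be tested term by term.
  rw [← le_div_iff₀ (Real.exp_pos _)]
  refine hM.exp_assocFun_le ht.le fun j => ?_
  rw [le_div_iff₀ (Real.exp_pos _), mul_comm,
    ← le_div_iff₀ (div_pos (pow_pos ht j) (hM.pos j))]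
  refine hM.exp_assocFun_le ht.le fun k => ?_
  rw [le_div_iff₀ (div_pos (pow_pos ht j) (hM.pos j)), div_mul_div_comm, ← pow_add]
  refine le_trans ?_ (hM.pow_div_le_exp_assocFun (by positivity) (k + j))
  rw [div_le_div_iff₀ (mul_pos (hM.pos _) (hM.pos _)) (hM.pos _), PNat.mk_coe, mul_pow]
  have h1 : C ^ (k + j) ≤ ((n + 1 : ℕ) : ℝ) ^ (k + j) :=
    pow_le_pow_left₀ (by linarith) hCN _
  have h2 : M (k + j) ≤ ((n + 1 : ℕ) : ℝ) ^ (k + j) * (M k * M j) := by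
    refine (hmg k j).trans ?_
    rw [mul_assoc]
    exact mul_le_mul_of_nonneg_right h1 (mul_pos (hM.pos _) (hM.pos _)).le
  refine (mul_le_mul_of_nonneg_left h2 (pow_pos ht (k + j)).le).trans_eq (by ring)

theorem IsWeightSequence.seqWeight_antitone (hM : IsWeightSequence M) {a b : ℝ} (ha : 0 ≤ a)
    (hab : a ≤ b) {t : ℝ} (ht : 0 ≤ t) : (seqWeight M b t : ℝ) ≤ seqWeight M a t :=
  Real.exp_le_exp.2 (neg_le_neg (hM.assocFun_mono (mul_nonneg ha ht)
    (mul_le_mul_of_nonneg_right hab ht)))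

theorem IsWeightSequence.lowerDilatation_antitone (hM : IsWeightSequence M) (m n : ℕ+)
    (hmn : m ≤ n) (t : ℝ) (ht : 0 ≤ t) :
    (lowerDilatation M n t : ℝ) ≤ lowerDilatation M m t :=
  hM.seqWeight_antitone (Nat.cast_nonneg _) (by exact_mod_cast hmn) ht

theorem IsWeightSequence.upperDilatation_monotone (hM : IsWeightSequence M) {m n : ℕ+}
    (hmn : m ≤ n) {t : ℝ} (ht : 0 ≤ t) :
    (upperDilatation M m t : ℝ) ≤ upperDilatation M n t :=
  hM.seqWeight_antitone (by positivity)
    (one_div_le_one_div_of_le (by exact_mod_cast m.pos) (by exact_mod_cast hmn)) ht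

end Weights

/-! ### Moderate growth implies continuous multiplication -/

section Multiplication

theorem mul_mem_HInf {v w : RadialWeight} (h : ∀ t, 0 ≤ t → (w t : ℝ) ≤ v t * v t) {f g : ℂ → ℂ}
    (hf : f ∈ HInf v) (hg : g ∈ HInf v) : f * g ∈ HInf w ∧
      ∀ z, ‖(f * g) z‖ * (w ‖z‖ : ℝ) ≤ hInfSeminorm v ⟨f, hf⟩ * hInfSeminorm v ⟨g, hg⟩ := by
  have key : ∀ z, ‖(f * g) z‖ * (w ‖z‖ : ℝ) ≤ hInfSeminorm v ⟨f, hf⟩ * hInfSeminorm v ⟨g, hg⟩ := by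
    intro z
    calc ‖(f * g) z‖ * (w ‖z‖ : ℝ) ≤ ‖(f * g) z‖ * (v ‖z‖ * v ‖z‖) :=
          mul_le_mul_of_nonneg_left (h _ (norm_nonneg z)) (norm_nonneg _)
      _ = (‖f z‖ * v ‖z‖) * (‖g z‖ * v ‖z‖) := by
          rw [Pi.mul_apply, norm_mul]; ring
      _ ≤ _ := mul_le_mul (le_hInfSeminorm ⟨f, hf⟩ z) (le_hInfSeminorm ⟨g, hg⟩ z)
          (mul_nonneg (norm_nonneg _) (v ‖z‖).2.le) (apply_nonneg _ _)
  refine ⟨⟨hf.1.mul hg.1, hInfSeminorm v ⟨f, hf⟩ * hInfSeminorm v ⟨g, hg⟩, ?_⟩, key⟩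
  rintro _ ⟨z, rfl⟩
  exact key z

/-- Pointwise multiplication on a space of functions closed under it. -/
def mulBilin (E : Submodule ℂ (ℂ → ℂ)) (h : ∀ f ∈ E, ∀ g ∈ E, f * g ∈ E) : E →ₗ[ℂ] E →ₗ[ℂ] E :=
  LinearMap.mk₂ ℂ (fun f g => ⟨(f : ℂ → ℂ) * (g : ℂ → ℂ), h f f.2 g g.2⟩)
    (fun _ _ _ => Subtype.ext (add_mul _ _ _)) (fun _ _ _ => Subtype.ext (smul_mul_assoc _ _ _))
    (fun _ _ _ => Subtype.ext (mul_add _ _ _)) (fun _ _ _ => Subtype.ext (mul_smul_comm _ _ _))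

variable {M : ℕ → ℝ}

theorem seqWeight_le_mul_self {N : ℕ+} (hN : ∀ t, 0 ≤ t →
    Real.exp (assocFun M t) * Real.exp (assocFun M t) ≤ Real.exp (assocFun M ((N : ℕ) * t)))
    {c d : ℝ} (hc : 0 ≤ c) (hd : d = (N : ℕ) * c) (t : ℝ) (ht : 0 ≤ t) :
    (seqWeight M d t : ℝ) ≤ seqWeight M c t * seqWeight M c t := by
  have h := hN (c * t) (mul_nonneg hc ht)
  simp only [seqWeight, Real.exp_neg, ← mul_inv]
  rw [hd, mul_assoc]
  exact inv_anti₀ (mul_pos (Real.exp_pos _) (Real.exp_pos _)) h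

theorem ModerateGrowth.closedUnderContinuousMul_indLimit (h : ModerateGrowth M)
    (hM : IsWeightSequence M) :
    ClosedUnderContinuousMul (indLimit (lowerDilatation M))
      (indLimitTopology (lowerDilatation M)) := by
  obtain ⟨N, hN⟩ := h.exists_exp_assocFun_sq_le hM
  have hw : ∀ n : ℕ+, ∀ t, 0 ≤ t → (lowerDilatation M (N * n) t : ℝ) ≤
      lowerDilatation M n t * lowerDilatation M n t := fun n =>
    seqWeight_le_mul_self hN (Nat.cast_nonneg _) (by push_cast; rfl)
  have hmul : ∀ f ∈ indLimit (lowerDilatation M), ∀ g ∈ indLimit (lowerDilatation M),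
      f * g ∈ indLimit (lowerDilatation M) := by
    intro f hf g hg
    rw [hM.mem_indLimit_iff] at *
    obtain ⟨m, hm⟩ := hf
    obtain ⟨n, hn⟩ := hg
    have hmono := fun {i j : ℕ+} (hij : i ≤ j) => HInf_mono (hM.lowerDilatation_antitone i j hij)
    exact ⟨_, (mul_mem_HInf (hw (max m n)) (hmono (le_max_left m n) hm)
      (hmono (le_max_right m n) hn)).1⟩
  refine ⟨hmul, continuous_bilinear_indLimit hM.lowerDilatation_antitone (mulBilin _ hmul)
    fun n => ⟨N * n, 1, fun f g => ?_⟩⟩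
  have hfg := mul_mem_HInf (hw n) f.2 g.2
  exact ⟨⟨_, hfg.1⟩, rfl, (hInfSeminorm_le _ hfg.2).trans_eq (one_mul _).symm⟩

theorem ModerateGrowth.closedUnderContinuousMul_projLimit (h : ModerateGrowth M)
    (hM : IsWeightSequence M) :
    ClosedUnderContinuousMul (projLimit (upperDilatation M))
      (projLimitTopology (upperDilatation M)) := by
  obtain ⟨N, hN⟩ := h.exists_exp_assocFun_sq_le hM
  -- Here the larger index sits on the factors, since 1/n = N · 1/(Nn).
  have hw : ∀ n : ℕ+, ∀ t, 0 ≤ t → (upperDilatation M n t : ℝ) ≤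
      upperDilatation M (N * n) t * upperDilatation M (N * n) t := fun n =>
    seqWeight_le_mul_self hN (by positivity) (by
      have := N.pos
      have := n.pos
      push_cast
      field_simp)
  have hmul : ∀ f ∈ projLimit (upperDilatation M), ∀ g ∈ projLimit (upperDilatation M),
      f * g ∈ projLimit (upperDilatation M) := by
    intro f hf g hg
    simp only [projLimit, Submodule.mem_iInf] at *
    exact fun n => (mul_mem_HInf (hw n) (hf _) (hg _)).1
  refine ⟨hmul, ?_⟩
  let _ := projLimitTopology (upperDilatation M)
  have hP := withSeminorms_projLimit (upperDilatation M)
  refine hP.continuous_bilinear (mulBilin _ hmul) fun n =>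
    ⟨projSeminorm _ (N * n), hP.continuous_seminorm _, fun f g => ?_⟩
  exact hInfSeminorm_le _ (mul_mem_HInf (hw n) (iInf_le (fun k => HInf (upperDilatation M k)) _ f.2)
    (iInf_le (fun k => HInf (upperDilatation M k)) _ g.2)).2

end Multiplication

/-! ### Multiplication implies moderate growth -/

section Necessity

variable {M : ℕ → ℝ}

theorem IsWeightSequence.norm_pow_mul_seqWeight_le (hM : IsWeightSequence M) {c : ℝ} (hc : 0 < c)
    (j : ℕ) (z : ℂ) : ‖z ^ j‖ * (seqWeight M c ‖z‖ : ℝ) ≤ M j / c ^ j := by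
  have h := hM.pow_div_le_exp_assocFun (mul_nonneg hc.le (norm_nonneg z)) j
  have hj := hM.pos j
  rw [div_le_iff₀ hj, mul_pow] at h
  simp only [seqWeight, Real.exp_neg, norm_pow]
  rw [← div_eq_mul_inv, div_le_div_iff₀ (Real.exp_pos _) (by positivity)]
  linarith

theorem IsWeightSequence.pow_mem_projLimit (hM : IsWeightSequence M) (j : ℕ) :
    (fun z : ℂ => z ^ j) ∈ projLimit (upperDilatation M) := by
  simp only [projLimit, Submodule.mem_iInf]
  refine fun n => ⟨differentiable_pow j, M j / (1 / ((n : ℕ) : ℝ)) ^ j, ?_⟩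
  rintro _ ⟨z, rfl⟩
  exact hM.norm_pow_mul_seqWeight_le (one_div_pos.2 (by exact_mod_cast n.pos)) j z

theorem IsLogConvex.moderateGrowth_of_projLimit (hlc : IsLogConvex M) (hM : IsWeightSequence M)
    (h : ClosedUnderContinuousMul (projLimit (upperDilatation M))
      (projLimitTopology (upperDilatation M))) : ModerateGrowth M := by
  obtain ⟨hmul, hcont⟩ := h
  let _ := projLimitTopology (upperDilatation M)
  have hmono : Monotone (projSeminorm (upperDilatation M)) := by
    intro m n hmn f
    refine hInfSeminorm_le _ fun z => ?_
    exact (mul_le_mul_of_nonneg_left (hM.upperDilatation_monotone hmn (norm_nonneg z))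
      (norm_nonneg _)).trans (le_hInfSeminorm (Submodule.inclusion
        (iInf_le (fun k => HInf (upperDilatation M k)) n) f) z)
  obtain ⟨m, C, hC, hB⟩ :=
    (withSeminorms_projLimit (upperDilatation M)).exists_bound_of_continuous_bilinear hmono
      (mulBilin _ hmul) hcont 1
  let e : ℕ → projLimit (upperDilatation M) := fun j => ⟨_, hM.pow_mem_projLimit j⟩
  have hm : (0 : ℝ) < (m : ℕ) := by exact_mod_cast m.pos
  have hup : ∀ j, projSeminorm _ m (e j) ≤ M j * ((m : ℕ) : ℝ) ^ j := fun j =>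
    hInfSeminorm_le _ fun z => (hM.norm_pow_mul_seqWeight_le (one_div_pos.2 hm) j z).trans_eq
      (by simp)
  -- The norm of z^p is bounded below by its value at z = M_(p+1)/M_p, where the weight is
  -- explicitly controlled.
  have hdown : ∀ p, M p ≤ projSeminorm _ 1 (e p) := by
    intro p
    have hs : 0 < M (p + 1) / M p := div_pos (hM.pos _) (hM.pos _)
    refine le_trans ?_ (le_hInfSeminorm (Submodule.inclusion
        (iInf_le (fun k => HInf (upperDilatation M k)) 1) (e p)) ((M (p + 1) / M p : ℝ) : ℂ))
    change M p ≤ ‖((M (p + 1) / M p : ℝ) : ℂ) ^ p‖ * Real.exp (-assocFun M (1 / ((1 : ℕ) : ℝ) * _))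
    rw [norm_pow, Complex.norm_real, Real.norm_of_nonneg hs.le, Nat.cast_one, div_one, one_mul,
      Real.exp_neg, ← div_eq_mul_inv, le_div_iff₀ (Real.exp_pos _), mul_comm,
      ← le_div_iff₀ (hM.pos p)]
    exact hlc.exp_assocFun_ratio hM p
  refine hM.moderateGrowth_of_le (A := C) hm.le fun j k => ?_
  have hjk : mulBilin _ hmul (e j) (e k) = e (j + k) :=
    Subtype.ext (funext fun z => (pow_add z j k).symm)
  have h1 := hB (e j) (e k) _ _ (mul_pos (hM.pos j) (pow_pos hm j))
    (mul_pos (hM.pos k) (pow_pos hm k)) (hup j) (hup k)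
  rw [hjk] at h1
  refine ((hdown _).trans h1).trans_eq ?_
  rw [pow_add]
  ring

/-- The entire function `z ↦ ∑ z ^ j / (2 ^ j M_j)`. -/
noncomputable def weightSeries (M : ℕ → ℝ) (z : ℂ) : ℂ :=
  ∑' j : ℕ, z ^ j / ((2 ^ j * M j : ℝ) : ℂ)

theorem IsWeightSequence.norm_weightSeries_term_le (hM : IsWeightSequence M) {z : ℂ} {t : ℝ}
    (hz : ‖z‖ ≤ t) (j : ℕ) : ‖z ^ j / ((2 ^ j * M j : ℝ) : ℂ)‖ ≤
      Real.exp (assocFun M t) * (1 / 2) ^ j := by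
  have ht := (norm_nonneg z).trans hz
  have hj := hM.pos j
  rw [norm_div, norm_pow, Complex.norm_real, Real.norm_of_nonneg (by positivity)]
  calc ‖z‖ ^ j / (2 ^ j * M j) ≤ t ^ j / (2 ^ j * M j) := by gcongr
    _ = t ^ j / M j * (1 / 2) ^ j := by
      rw [div_pow, one_pow]
      field_simp
    _ ≤ _ := mul_le_mul_of_nonneg_right (hM.pow_div_le_exp_assocFun ht j) (by positivity)

/-- The factors 2^(-j) turn the termwise bound exp ω_M(|z|) into a geometric series, so the sum
costs only a factor 2. -/
theorem IsWeightSequence.weightSeries_mem (hM : IsWeightSequence M) :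
    weightSeries M ∈ HInf (lowerDilatation M 1) := by
  have hgeo : ∀ t, HasSum (fun j : ℕ => Real.exp (assocFun M t) * (1 / 2) ^ j)
      (Real.exp (assocFun M t) * 2) := fun t => hasSum_geometric_two.mul_left _
  refine ⟨fun z => ?_, 2, ?_⟩
  · have h := Complex.differentiableOn_tsum_of_summable_norm (hgeo (‖z‖ + 1)).summable
      (F := fun (j : ℕ) (z : ℂ) => z ^ j / ((2 ^ j * M j : ℝ) : ℂ))
      (fun j => (by fun_prop : Differentiable ℂ _).differentiableOn)
      (Metric.isOpen_ball (x := (0 : ℂ)) (ε := ‖z‖ + 1))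
      (fun j w hw => hM.norm_weightSeries_term_le (mem_ball_zero_iff.1 hw).le j)
    exact h.differentiableAt (Metric.isOpen_ball.mem_nhds (by simp))
  · rintro _ ⟨z, rfl⟩
    have h1 : ‖weightSeries M z‖ ≤ Real.exp (assocFun M ‖z‖) * 2 :=
      tsum_of_norm_bounded (hgeo _) (hM.norm_weightSeries_term_le le_rfl)
    change _ * Real.exp (-assocFun M (((1 : ℕ) : ℝ) * ‖z‖)) ≤ _
    rw [Nat.cast_one, one_mul, Real.exp_neg, ← div_eq_mul_inv, div_le_iff₀ (Real.exp_pos _)]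
    linarith

/-- On the nonnegative real axis all terms are nonnegative, so the sum dominates each of them. -/
theorem IsWeightSequence.le_norm_weightSeries (hM : IsWeightSequence M) {t : ℝ} (ht : 0 ≤ t)
    (j : ℕ) : t ^ j / (2 ^ j * M j) ≤ ‖weightSeries M t‖ := by
  have hnn : ∀ i, 0 ≤ t ^ i / (2 ^ i * M i) := fun i => by
    have := hM.pos i
    positivity
  have hsum : Summable fun i : ℕ => t ^ i / (2 ^ i * M i) := by
    refine Summable.of_nonneg_of_le hnn (fun i => ?_)
      (summable_geometric_two.mul_left (Real.exp (assocFun M t)))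
    have h := hM.norm_weightSeries_term_le (z := t) (t := t)
      (by rw [Complex.norm_real, Real.norm_of_nonneg ht]) i
    rwa [← Complex.ofReal_pow, ← Complex.ofReal_div, Complex.norm_real,
      Real.norm_of_nonneg (hnn i)] at h
  have heq : weightSeries M t = ((∑' i : ℕ, t ^ i / (2 ^ i * M i) : ℝ) : ℂ) := by
    rw [Complex.ofReal_tsum, weightSeries]
    simp only [Complex.ofReal_pow, Complex.ofReal_div]
  rw [heq, Complex.norm_real, Real.norm_of_nonneg (tsum_nonneg hnn)]
  exact hsum.le_tsum j fun i _ => hnn i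

theorem IsLogConvex.moderateGrowth_of_indLimit (hlc : IsLogConvex M) (hM : IsWeightSequence M)
    (h : ∀ f ∈ indLimit (lowerDilatation M), ∀ g ∈ indLimit (lowerDilatation M),
      f * g ∈ indLimit (lowerDilatation M)) : ModerateGrowth M := by
  have hF := hM.mem_indLimit_iff.2 ⟨1, hM.weightSeries_mem⟩
  obtain ⟨n, -, A, hA⟩ := hM.mem_indLimit_iff.1 (h _ hF _ hF)
  have hn : (0 : ℝ) < (n : ℕ) := by exact_mod_cast n.pos
  -- The `n` is the step containing the square of the series; the 2 comes from evaluating at `2 *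
  -- t`, which cancels the factors 2^(-j).
  refine hlc.moderateGrowth_of_exp_assocFun hM (A := A) (H := (n : ℕ) * 2) (by positivity)
    fun t ht j k => ?_
  have hle : ∀ i, t ^ i / M i ≤ ‖weightSeries M ((2 * t : ℝ) : ℂ)‖ := fun i => by
    refine le_trans (le_of_eq ?_) (hM.le_norm_weightSeries (by positivity) i)
    rw [mul_pow, mul_div_mul_left _ _ (by positivity)]
  have h1 := hA ⟨((2 * t : ℝ) : ℂ), rfl⟩
  change ‖weightSeries M _ * weightSeries M _‖ * Real.exp (-assocFun M (((n : ℕ) : ℝ) * ‖_‖)) ≤ A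
    at h1
  rw [norm_mul, Complex.norm_real, Real.norm_of_nonneg (by positivity), ← mul_assoc, Real.exp_neg,
    ← div_eq_mul_inv, div_le_iff₀ (Real.exp_pos _)] at h1
  exact (mul_le_mul (hle j) (hle k) (div_nonneg (pow_pos ht k).le (hM.pos k).le)
    (norm_nonneg _)).trans h1

end Necessity
theorem mainTheorem8 (M : ℕ → ℝ) (hM : IsWeightSequence M) (hlc : IsLogConvex M) :
    List.TFAE
      [ClosedUnderContinuousMul (indLimit (lowerDilatation M))
          (indLimitTopology (lowerDilatation M)),
        ClosedUnderContinuousMul (projLimit (upperDilatation M))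
          (projLimitTopology (upperDilatation M)),
        ModerateGrowth M] := by
  tfae_have 1 → 3 := fun h => hlc.moderateGrowth_of_indLimit hM h.1
  tfae_have 2 → 3 := hlc.moderateGrowth_of_projLimit hM
  tfae_have 3 → 1 := fun h => h.closedUnderContinuousMul_indLimit hM
  tfae_have 3 → 2 := fun h => h.closedUnderContinuousMul_projLimit hM
  tfae_finish
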